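/- **Conventions.** Groups are discrete, C*-algebras need not be unital, and $M(A)$ is the multiplier algebra of $A$. A cochain with values in $\mathrm{U}(1)$ (trivial action, written multiplicatively) is normalized if it equals $1$ whenever one of its arguments is $1$. Differentials are $$(dc)(f,g,h)=c(g,h)^{-1}c(fg,h)\,c(f,gh)^{-1}c(f,g),$$ $$(d\omega)(f,g,h,k)=\omega(g,h,k)^{-1}\omega(fg,h,k)\,\omega(f,gh,k)^{-1}\omega(f,g,hk)\,\omega(f,g,h)^{-1}.$$ For a group $Q$ and $\omega\in Z^3(Q,\mathrm{U}(1))$, an *$\omega$-anomalous action* of $Q$ on a C*-algebra $A$ consists of $*$-automorphisms $\alpha_q$ of $A$ $(q\in Q)$ and unitaries $m_{q,r}\in M(A)$ $(q,r\in Q)$ such that, with $\alpha_q$ extended to $M(A)$, $$m_{q,r}\,\alpha_q(\alpha_r(x))=\alpha_{qr}(x)\,m_{q,r}\quad(x\in A),\qquad \omega(q,r,s)\,m_{qr,s}\,m_{q,r}=m_{q,rs}\,\alpha_q(m_{r,s}).$$ For an action $\pi$ of a group $K$ on a C*-algebra $B$ and a normalized 2-cocycle $\sigma:K\times K\to\mathrm{U}(1)$,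 the *reduced twisted crossed product* $B\rtimes_{\pi,\sigma}K$ is the closed $*$-algebra of operators on $\ell^2(K,H)$ generated by the operators $a\,u_k$ ($a\in B$, $k\in K$), where $B$ is faithfully represented on a Hilbert space $H$ by $\varphi$ and $$(a\xi)(h)=\varphi(\pi(h)^{-1}(a))\,\xi(h),\qquad (u_k\xi)(h)=\sigma(k,k^{-1}h)\,\xi(k^{-1}h),$$ so that $u_ku_l=\sigma(k,l)u_{kl}$ and $u_ka=\pi(k)(a)u_k$. (Up to canonical isomorphism it does not depend on $\varphi$; the statement holds for every faithful $\varphi$.) **Theorem.** Let $Q$ be a group and $\omega\in Z^3(Q,\mathrm{U}(1))$ a normalized 3-cocycle. Let $\rho:G\to Q$ be a surjective group homomorphism with kernel $K$, let $c\in C^2(G,\mathrm{U}(1))$ be a normalized cochain with $dc=\rho^*(\omega)$, and let $\pi:G\to\mathrm{Aut}(B)$ be an action of $G$ by $*$-automorphisms on a C*-algebra $B$. Then there exists an $\omega$-anomalous action of $Q$ on the reduced twisted crossed product $B\rtimes_{\pi|_K,\,c|_K}K$. Moreover, for every set-theoretic section $q\mapsto\hat q$ of $\rho$, writing $\hat q\hat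 r=\gamma(q,r)\,\widehat{qr}$ with $\gamma(q,r)\in K$, there is such an action with $$\alpha_q(a\,u_k)=c(\hat qk\hat q^{-1},\hat q)^{-1}\,c(\hat q,k)\;\pi(\hat q)(a)\,u_{\hat qk\hat q^{-1}}\qquad(a\in B,\ k\in K),$$ $$m_{q,r}=c(\hat q,\hat r)^{-1}\,c(\gamma(q,r),\widehat{qr})\;u_{\gamma(q,r)}^{*}.$$ -/

import Mathlib

open scoped MultiplierAlgebra

/-! ### Group cochains with values in `U(1)` (trivial action), written multiplicatively -/

/-- A 2-cochain is normalized if it is `1` as soon as one of its arguments is `1`. -/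
def IsNormalizedCochain₂ {G : Type*} [Group G] (c : G → G → Circle) : Prop :=
  ∀ f g : G, (f = 1 ∨ g = 1) → c f g = 1

/-- A 3-cochain is normalized if it is `1` as soon as one of its arguments is `1`. -/
def IsNormalizedCochain₃ {G : Type*} [Group G] (ω : G → G → G → Circle) : Prop :=
  ∀ f g h : G, (f = 1 ∨ g = 1 ∨ h = 1) → ω f g h = 1

/-- The differential `C²(G, U(1)) → C³(G, U(1))`. -/
noncomputable def cochainD₂ {G : Type*} [Group G] (c : G → G → Circle) (f g h : G) : Circle :=
  (c g h)⁻¹ * c (f * g) h * (c f (g * h))⁻¹ * c f g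

/-- The differential `C³(G, U(1)) → C⁴(G, U(1))`. -/
noncomputable def cochainD₃ {G : Type*} [Group G] (ω : G → G → G → Circle) (f g h k : G) : Circle :=
  (ω g h k)⁻¹ * ω (f * g) h k * (ω f (g * h) k)⁻¹ * ω f g (h * k) * (ω f g h)⁻¹

/-- `ω ∈ Z³(G, U(1))`: a normalized 3-cocycle. -/
structure IsNormalizedCocycle₃ {G : Type*} [Group G] (ω : G → G → G → Circle) : Prop where
  normalized : IsNormalizedCochain₃ ω
  cocycle : ∀ f g h k : G, cochainD₃ ω f g h k = 1

/-! ### Anomalous actions -/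

/-- The unique extension of a `*`-automorphism `α` of `A` to the multiplier algebra `M(A)`: it
sends a multiplier `m` to the multiplier `x ↦ α (m (α⁻¹ x))`, `x ↦ α ((α⁻¹ x) m)`. -/
noncomputable def multiplierExtend {A : Type*} [NonUnitalCStarAlgebra A] (α : A ≃⋆ₐ[ℂ] A)
    (m : 𝓜(ℂ, A)) : 𝓜(ℂ, A) where
  fst := LinearMap.mkContinuous
    { toFun := fun x => α (m.fst (α.symm x))
      map_add' := fun x y => by simp
      map_smul' := fun z x => by simp } ‖m.fst‖ (fun x => by
        have h := m.fst.le_opNorm (α.symm x)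
        rw [StarAlgEquiv.norm_map] at h
        simpa [StarAlgEquiv.norm_map] using h)
  snd := LinearMap.mkContinuous
    { toFun := fun x => α (m.snd (α.symm x))
      map_add' := fun x y => by simp
      map_smul' := fun z x => by simp } ‖m.snd‖ (fun x => by
        have h := m.snd.le_opNorm (α.symm x)
        rw [StarAlgEquiv.norm_map] at h
        simpa [StarAlgEquiv.norm_map] using h)
  central := fun x y => by
    have h := congrArg α (m.central (α.symm x) (α.symm y))
    simpa using h

/-- An `ω`-anomalous action of a group `Q` on a (not necessarily unital) C⋆-algebra `A`:
`*`-automorphisms `α q` and unitaries `m q r` of the multiplier algebra `M(A)` with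
`m q r * α q (α r x) = α (q r) x * m q r` for all `x` in `A`, and
`ω(q, r, s) m (q r) s * m q r = m q (r s) * α q (m r s)`. -/
structure AnomalousAction {Q : Type*} [Group Q] (ω : Q → Q → Q → Circle)
    (A : Type*) [NonUnitalCStarAlgebra A] where
  α : Q → (A ≃⋆ₐ[ℂ] A)
  m : Q → Q → 𝓜(ℂ, A)
  m_unitary : ∀ q r : Q, m q r ∈ unitary 𝓜(ℂ, A)
  intertwines : ∀ (q r : Q) (x : A),
    m q r * (α q (α r x) : 𝓜(ℂ, A)) = (α (q * r) x : 𝓜(ℂ, A)) * m q r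
  associator : ∀ q r s : Q,
    (ω q r s : ℂ) • (m (q * r) s * m q r) = m q (r * s) * multiplierExtend (α q) (m r s)

/-! ### Reduced twisted crossed products by discrete groups -/

section CrossedProduct

variable {K : Type*} {H : Type*} [NormedAddCommGroup H] [InnerProductSpace ℂ H]

/-- The Hilbert space `ℓ²(K, H)`. -/
abbrev EllTwo (K H : Type*) [NormedAddCommGroup H] : Type _ := lp (fun _ : K => H) 2

/-- If `e` is a permutation of `K` and `(T h)` a bounded family of operators on `H`, then
`h ↦ T h (ξ (e h))` is square summable for `ξ ∈ ℓ²(K, H)`, with the expected norm bound. -/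
theorem summable_weighted (e : K ≃ K) (T : K → (H →L[ℂ] H)) (C : ℝ) (hC : 0 ≤ C)
    (hT : ∀ h, ‖T h‖ ≤ C) (ξ : EllTwo K H) :
    ∃ hm : Memℓp (fun h => T h (ξ (e h))) 2,
      ‖(⟨fun h => T h (ξ (e h)), hm⟩ : EllTwo K H)‖ ≤ C * ‖ξ‖ := by
  have h2 : (0 : ℝ) < (2 : ENNReal).toReal := by norm_num
  have hle : ∀ h, ‖T h (ξ (e h))‖ ^ (2 : ENNReal).toReal
      ≤ C ^ (2 : ENNReal).toReal * ‖ξ (e h)‖ ^ (2 : ENNReal).toReal := fun h => by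
    rw [← Real.mul_rpow hC (norm_nonneg _)]
    refine Real.rpow_le_rpow (norm_nonneg _) ?_ h2.le
    exact (T h).le_of_opNorm_le (hT h) _
  have hs : Summable fun h => C ^ (2 : ENNReal).toReal * ‖ξ (e h)‖ ^ (2 : ENNReal).toReal :=
    ((e.summable_iff (f := fun h => ‖ξ h‖ ^ (2 : ENNReal).toReal)).2
      ((lp.memℓp ξ).summable h2)).mul_left _
  have hs' := Summable.of_nonneg_of_le (fun h => by positivity) hle hs
  refine ⟨memℓp_gen hs', ?_⟩
  refine lp.norm_le_of_tsum_le h2 (by positivity) ?_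
  refine (hs'.tsum_le_tsum hle hs).trans ?_
  rw [tsum_mul_left, e.tsum_eq (fun h => ‖ξ h‖ ^ (2 : ENNReal).toReal),
    Real.mul_rpow hC (norm_nonneg _), lp.norm_rpow_eq_tsum h2]

/-- The bounded operator `(S ξ)(h) = T h (ξ (e h))` on `ℓ²(K, H)`, for a permutation `e` of `K`
and a family `(T h)` of operators on `H` bounded by `C`. -/
noncomputable def weightedShift (e : K ≃ K) (T : K → (H →L[ℂ] H)) (C : ℝ) (hC : 0 ≤ C)
    (hT : ∀ h, ‖T h‖ ≤ C) : EllTwo K H →L[ℂ] EllTwo K H :=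
  LinearMap.mkContinuous
    { toFun := fun ξ => ⟨fun h => T h (ξ (e h)), (summable_weighted e T C hC hT ξ).choose⟩
      map_add' := fun ξ η => lp.ext (funext fun h => by
        change T h ((ξ + η : EllTwo K H) (e h)) = T h (ξ (e h)) + T h (η (e h))
        simp)
      map_smul' := fun z ξ => lp.ext (funext fun h => by
        change T h ((z • ξ : EllTwo K H) (e h)) = z • T h (ξ (e h))
        simp) }
    C (fun ξ => (summable_weighted e T C hC hT ξ).choose_spec)

variable [Group K] [CompleteSpace H] {B : Type*} [NonUnitalCStarAlgebra B]

/-- The copy of `a ∈ B` on `ℓ²(K, H)`: `(a ξ)(h) = φ (π(h)⁻¹ a) (ξ h)`. -/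
noncomputable def regularCoeff (φ : B →⋆ₙₐ[ℂ] (H →L[ℂ] H)) (π : K →* (B ≃⋆ₐ[ℂ] B)) (a : B) :
    EllTwo K H →L[ℂ] EllTwo K H :=
  weightedShift (Equiv.refl K) (fun h => φ ((π h)⁻¹ a)) ‖a‖ (norm_nonneg a) (fun _ =>
    (NonUnitalStarAlgHom.norm_apply_le φ _).trans (StarAlgEquiv.norm_map _ a).le)

/-- The twisted left translation `u_k` on `ℓ²(K, H)`: `(u_k ξ)(h) = σ(k, k⁻¹h) ξ(k⁻¹h)`, that is
`u_k (δ_l ⊗ v) = σ(k, l) δ_{kl} ⊗ v`. -/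
noncomputable def regularUnitary (H : Type*) [NormedAddCommGroup H] [InnerProductSpace ℂ H]
    (σ : K → K → Circle) (k : K) : EllTwo K H →L[ℂ] EllTwo K H :=
  weightedShift (Equiv.mulLeft k⁻¹)
    (fun h => (σ k (k⁻¹ * h) : ℂ) • ContinuousLinearMap.id ℂ H) 1 zero_le_one (fun _ => by
      rw [norm_smul, Circle.norm_coe, one_mul]
      exact ContinuousLinearMap.norm_id_le)

/-- The reduced twisted crossed product `B ⋊_{π,σ} K` of a C⋆-algebra `B` by a discrete group `K`,
for an action `π` of `K` on `B` and a normalized 2-cocycle `σ` of `K` in `U(1)`: the closed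
`*`-subalgebra of the bounded operators on `ℓ²(K, H)` generated by the operators `a u_k`, with
`a ∈ B` and `k ∈ K`. Here `φ` is a faithful representation of `B` on the Hilbert space `H`; up to
canonical isomorphism the algebra does not depend on it. The generators satisfy
`u_k u_l = σ(k, l) u_{kl}` and `u_k a = π(k)(a) u_k`. -/
noncomputable def reducedTwistedCrossedProduct (φ : B →⋆ₙₐ[ℂ] (H →L[ℂ] H))
    (π : K →* (B ≃⋆ₐ[ℂ] B)) (σ : K → K → Circle) :
    NonUnitalStarSubalgebra ℂ (EllTwo K H →L[ℂ] EllTwo K H) :=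
  (NonUnitalStarAlgebra.adjoin ℂ
    {x | ∃ (a : B) (k : K), x = regularCoeff φ π a * regularUnitary H σ k}).topologicalClosure

instance isClosed_reducedTwistedCrossedProduct (φ : B →⋆ₙₐ[ℂ] (H →L[ℂ] H))
    (π : K →* (B ≃⋆ₐ[ℂ] B)) (σ : K → K → Circle) :
    IsClosed (reducedTwistedCrossedProduct φ π σ : Set (EllTwo K H →L[ℂ] EllTwo K H)) :=
  NonUnitalStarSubalgebra.isClosed_topologicalClosure _

/-- The element `a u_k` of the reduced twisted crossed product. -/
noncomputable def crossedMonomial (φ : B →⋆ₙₐ[ℂ] (H →L[ℂ] H))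
    (π : K →* (B ≃⋆ₐ[ℂ] B)) (σ : K → K → Circle) (a : B) (k : K) :
    reducedTwistedCrossedProduct φ π σ :=
  ⟨regularCoeff φ π a * regularUnitary H σ k,
    NonUnitalStarSubalgebra.le_topologicalClosure _
      (NonUnitalStarAlgebra.subset_adjoin ℂ _ ⟨a, k, rfl⟩)⟩

end CrossedProduct

/-! ### Group extensions -/

/-- `g k g⁻¹` as an element of the kernel. -/
def kerConj {G Q : Type*} [Group G] [Group Q] (ρ : G →* Q) (g : G) (k : ρ.ker) : ρ.ker :=
  ⟨g * k * g⁻¹, (MonoidHom.normal_ker ρ).conj_mem k k.2 g⟩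

/-- For a section `s` of `ρ`, the element `γ(q, r)` of the kernel of `ρ` with
`s q * s r = γ(q, r) * s (q r)`. -/
def sectionCocycle {G Q : Type*} [Group G] [Group Q] (ρ : G →* Q) (s : Q → G)
    (hs : ∀ q, ρ (s q) = q) (q r : Q) : ρ.ker :=
  ⟨s q * s r * (s (q * r))⁻¹, by simp [MonoidHom.mem_ker, hs]⟩

/-- The restriction of a 2-cochain to the kernel of `ρ`. -/
def restrictKer {G Q : Type*} [Group G] [Group Q] (ρ : G →* Q) (c : G → G → Circle) :
    ρ.ker → ρ.ker → Circle :=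
  fun k l => c k l

/-! Write `K` for the kernel of `ρ`. Since `ω` is normalized, `dc = ρ^*ω` says that `c` obeys the
2-cocycle identity on every triple with an entry in `K`. Hence `c|_K` is a 2-cocycle, and
conjugation by `g`, corrected by `χ_g(k) = c(gkg⁻¹, g)⁻¹ c(g, k)`, respects the twisted
multiplication (`conjScalar_mul_left`). The resulting automorphisms satisfy `α_{gh} = α_g α_h`
(`conjScalar_mul_right`), and `α_l` is conjugation by `u_l` for `l` in `K`. So for a section `s`,
`α_{s q} α_{s r}` and `α_{s (q r)}` differ by conjugation by `u_{γ(q, r)}`. Choosing these unitaries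
with the phases `splitScalar`, their associativity involves `c` on one triple outside `K`, and that
triple contributes exactly `ω` (`splitScalar_associator`).

The analytic point is that `α_g` exists on the reduced crossed product. No unitary of `H` need
implement `π g` in the representation `φ`, so `α_g` is obtained from its graph: in the C⋆-algebra
generated by the pairs `(a u_k, α_g(a u_k))`, corresponding matrix entries have equal norms, so both
coordinate projections are injective (`exists_crossedProduct_starAlgEquiv`). All other relations are
checked on monomials and extended by density. -/

/-! ### Cochain identities -/

section Cochains

variable {Q G : Type*} [Group Q] [Group G]

/-- The scalar `c(g k g⁻¹, g)⁻¹ c(g, k)` by which conjugation by `g` twists `u_k`. -/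
noncomputable def conjScalar (c : G → G → Circle) (g k : G) : Circle :=
  (c (g * k * g⁻¹) g)⁻¹ * c g k

/-- The scalar `c(g, h) c(k, p)⁻¹` for `g h = k p`. -/
noncomputable def splitScalar (c : G → G → Circle) (g h k p : G) : Circle :=
  c g h * (c k p)⁻¹

theorem cochainD₂_eq_iff (c : G → G → Circle) (f g h : G) (z : Circle) :
    cochainD₂ c f g h = z ↔ z * c g h * c f (g * h) = c (f * g) h * c f g := by
  -- In additive notation the identity is linear in an abelian group, which `grind` can decide. The
  -- cochain lemmas below use the same device.
  rw [cochainD₂, ← Additive.ofMul.injective.eq_iff (b := z),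
    ← Additive.ofMul.injective.eq_iff (a := z * _ * _)]
  simp only [ofMul_mul, ofMul_inv]
  constructor <;> intro <;> grind

variable {ρ : G →* Q} {ω : Q → Q → Q → Circle} {c : G → G → Circle}

theorem cochain_identity (hω : IsNormalizedCochain₃ ω)
    (hdc : ∀ f g h : G, cochainD₂ c f g h = ω (ρ f) (ρ g) (ρ h)) (f g h : G)
    (hk : ρ f = 1 ∨ ρ g = 1 ∨ ρ h = 1) :
    c g h * c f (g * h) = c (f * g) h * c f g := by
  simpa [hω _ _ _ hk] using (cochainD₂_eq_iff c f g h _).1 (hdc f g h)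

/-- The cocycle identities at `(g, k, l)`, `(gkg⁻¹, g, l)` and `(gkg⁻¹, glg⁻¹, g)` combine to this.
It is what makes conjugation by `g` multiplicative on twisted monomials. -/
theorem conjScalar_mul_left (hω : IsNormalizedCochain₃ ω)
    (hdc : ∀ f g h : G, cochainD₂ c f g h = ω (ρ f) (ρ g) (ρ h)) (g : G) {k l : G}
    (hk : ρ k = 1) (hl : ρ l = 1) :
    conjScalar c g (k * l) * c k l =
      conjScalar c g k * conjScalar c g l * c (g * k * g⁻¹) (g * l * g⁻¹) := by
  have h1 := cochain_identity hω hdc g k l (by simp [hk])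
  have h2 := cochain_identity hω hdc (g * k * g⁻¹) g l (by simp [hl])
  have h3 := cochain_identity hω hdc (g * k * g⁻¹) (g * l * g⁻¹) g (by simp [hl])
  rw [← Additive.ofMul.injective.eq_iff] at h1 h2 h3 ⊢
  simp only [conjScalar, ofMul_mul, ofMul_inv, mul_assoc,
    inv_mul_cancel_left, inv_mul_cancel, mul_one] at h1 h2 h3 ⊢
  grind

/-- No anomaly appears here: `k` or a conjugate of it occurs in each of the three triples used, so
`ω` drops out even though `g` and `h` are arbitrary. -/
theorem conjScalar_mul_right (hω : IsNormalizedCochain₃ ω)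
    (hdc : ∀ f g h : G, cochainD₂ c f g h = ω (ρ f) (ρ g) (ρ h)) (g h : G) {k : G}
    (hk : ρ k = 1) :
    conjScalar c (g * h) k = conjScalar c h k * conjScalar c g (h * k * h⁻¹) := by
  have h1 := cochain_identity hω hdc g h k (by simp [hk])
  have h2 := cochain_identity hω hdc g (h * k * h⁻¹) h (by simp [hk])
  have h3 := cochain_identity hω hdc (g * (h * k * h⁻¹) * g⁻¹) g h (by simp [hk])
  rw [← Additive.ofMul.injective.eq_iff] at h1 h2 h3 ⊢
  simp only [conjScalar, ofMul_mul, ofMul_inv, mul_assoc, mul_inv_rev,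
    inv_mul_cancel, mul_one] at h1 h2 h3 ⊢
  grind

/-- The scalar part of `α_{lp}(x) u_l = u_l α_p(x)`: multiplying `p` by a kernel element changes the
automorphism by an inner one. -/
theorem conjScalar_mul_of_ker (hω : IsNormalizedCochain₃ ω)
    (hdc : ∀ f g h : G, cochainD₂ c f g h = ω (ρ f) (ρ g) (ρ h)) (p : G) {l k : G}
    (hl : ρ l = 1) (hk : ρ k = 1) :
    conjScalar c (l * p) k * c (l * p * k * (l * p)⁻¹) l =
      conjScalar c p k * c l (p * k * p⁻¹) := by
  have h1 := cochain_identity hω hdc l p k (by simp [hk])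
  have h2 := cochain_identity hω hdc l (p * k * p⁻¹) p (by simp [hk])
  have h3 := cochain_identity hω hdc (l * p * k * (l * p)⁻¹) l p (by simp [hl])
  rw [← Additive.ofMul.injective.eq_iff] at h1 h2 h3 ⊢
  simp only [conjScalar, ofMul_mul, ofMul_inv, mul_assoc, mul_inv_rev,
    inv_mul_cancel, mul_one] at h1 h2 h3 ⊢
  grind

theorem conjScalar_mul_conjScalar (hω : IsNormalizedCochain₃ ω)
    (hdc : ∀ f g h : G, cochainD₂ c f g h = ω (ρ f) (ρ g) (ρ h)) {g h l p : G}
    (hl : ρ l = 1) (hgh : g * h = l * p) {k : G} (hk : ρ k = 1) :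
    conjScalar c h k * conjScalar c g (h * k * h⁻¹) * c (g * (h * k * h⁻¹) * g⁻¹) l =
      conjScalar c p k * c l (p * k * p⁻¹) := by
  rw [← conjScalar_mul_right hω hdc g h hk, ← conjScalar_mul_of_ker hω hdc p hl hk, hgh,
    show g * (h * k * h⁻¹) * g⁻¹ = g * h * k * (g * h)⁻¹ by group, hgh]

/-- Only the triple `(g, h, j)` may avoid the kernel, and it produces `ω`; the five others used
contain `l₁` or a conjugate of `l₃`, or `l₃` itself. -/
theorem splitScalar_associator (hω : IsNormalizedCochain₃ ω)
    (hdc : ∀ f g h : G, cochainD₂ c f g h = ω (ρ f) (ρ g) (ρ h))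
    {g h j p t v l₁ l₂ l₃ l₄ : G} (h₁ : g * h = l₁ * p) (h₂ : p * j = l₂ * v)
    (h₃ : h * j = l₃ * t) (h₄ : g * t = l₄ * v)
    (k₁ : ρ l₁ = 1) (k₃ : ρ l₃ = 1) :
    splitScalar c g h l₁ p * splitScalar c p j l₂ v * c l₁ l₂ =
      ω (ρ g) (ρ h) (ρ j) * (conjScalar c g l₃ * splitScalar c h j l₃ t *
        splitScalar c g t l₄ v * c (g * l₃ * g⁻¹) l₄) := by
  have e := (cochainD₂_eq_iff c g h j _).1 (hdc g h j)
  have e1 := cochain_identity hω hdc l₁ p j (by simp [k₁])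
  have e2 := cochain_identity hω hdc l₁ l₂ v (by simp [k₁])
  have e3 := cochain_identity hω hdc g l₃ t (by simp [k₃])
  have e4 := cochain_identity hω hdc (g * l₃ * g⁻¹) g t (by simp [k₃])
  have e5 := cochain_identity hω hdc (g * l₃ * g⁻¹) l₄ v (by simp [k₃])
  -- Both sides, multiplied by `v`, equal `g h j`, split off from the left or from the right.
  have hl : l₁ * l₂ = g * l₃ * g⁻¹ * l₄ := by
    apply mul_right_cancel (b := v)
    rw [mul_assoc, ← h₂, mul_assoc _ l₄, ← h₄, ← mul_assoc, ← h₁]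
    simp [mul_assoc, h₃]
  rw [h₂] at e1
  rw [hl] at e2
  rw [h₁, h₃] at e
  rw [inv_mul_cancel_right, h₄] at e4
  rw [← Additive.ofMul.injective.eq_iff] at e e1 e2 e3 e4 e5 ⊢
  simp only [conjScalar, splitScalar, ofMul_mul, ofMul_inv] at e e1 e2 e3 e4 e5 ⊢
  grind

end Cochains

/-! ### Isomorphisms of generated C⋆-algebras -/

theorem NonUnitalStarAlgebra.exists_starAlgEquiv_of_injOn {C C' : Type*}
    [NonUnitalCStarAlgebra C] [NonUnitalCStarAlgebra C'] (Φ : C →⋆ₙₐ[ℂ] C') (S : Set C)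
    (hΦ : ∀ d ∈ (NonUnitalStarAlgebra.adjoin ℂ S).topologicalClosure, Φ d = 0 → d = 0) :
    ∃ e : (NonUnitalStarAlgebra.adjoin ℂ S).topologicalClosure ≃⋆ₐ[ℂ]
      (NonUnitalStarAlgebra.adjoin ℂ (Φ '' S)).topologicalClosure, ∀ d, (e d : C') = Φ d := by
  set D := (NonUnitalStarAlgebra.adjoin ℂ S).topologicalClosure with hD
  set A := (NonUnitalStarAlgebra.adjoin ℂ (Φ '' S)).topologicalClosure with hA
  have : IsClosed (D : Set C) := NonUnitalStarSubalgebra.isClosed_topologicalClosure _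
  have hAc : IsClosed (A : Set C') := NonUnitalStarSubalgebra.isClosed_topologicalClosure _
  have hcont : Continuous Φ := 
    AddMonoidHomClass.continuous_of_bound Φ 1 fun x => by
      simpa using NonUnitalStarAlgHom.norm_apply_le Φ x
  let Ψ : D →⋆ₙₐ[ℂ] C' := Φ.comp (NonUnitalStarSubalgebraClass.subtype D)
  have hinj : Function.Injective Ψ := (injective_iff_map_eq_zero Ψ).2 fun d hd =>
    Subtype.ext (hΦ d d.2 hd)
  have hmem : ∀ d : D, Ψ d ∈ A := by
    have : D ≤ A.comap Φ := NonUnitalStarSubalgebra.topologicalClosure_minimal _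
      (NonUnitalStarAlgebra.adjoin_le fun x hx => NonUnitalStarSubalgebra.le_topologicalClosure _
        (NonUnitalStarAlgebra.subset_adjoin ℂ _ ⟨x, hx, rfl⟩)) (hAc.preimage hcont)
    exact fun d => this d.2
  -- An injective `*`-homomorphism of C⋆-algebras is isometric, so its range is closed and contains
  -- the closure of what the generators generate.
  have hrange : A ≤ NonUnitalStarAlgHom.range Ψ := by
    refine NonUnitalStarSubalgebra.topologicalClosure_minimal _
      (NonUnitalStarAlgebra.adjoin_le ?_) ?_
    · rintro _ ⟨x, hx, rfl⟩
      exact ⟨⟨x, NonUnitalStarSubalgebra.le_topologicalClosure _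
        (NonUnitalStarAlgebra.subset_adjoin ℂ _ hx)⟩, rfl⟩
    · exact (NonUnitalStarAlgHom.isometry Ψ hinj).isClosedEmbedding.isClosed_range
  refine ⟨StarAlgEquiv.ofBijective (NonUnitalStarAlgHom.codRestrict Ψ A hmem)
    ⟨fun d d' h => hinj (congrArg Subtype.val h), fun a => ?_⟩, fun d => rfl⟩
  obtain ⟨d, hd⟩ := hrange a.2
  exact ⟨d, Subtype.ext hd⟩

/-- A star-closed multiplicative set generates a C⋆-algebra in which its span is dense. -/
theorem NonUnitalStarAlgebra.coe_topologicalClosure_adjoin {C : Type*} [NonUnitalCStarAlgebra C]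
    {S : Set C} (hmul : ∀ x ∈ S, ∀ y ∈ S, x * y ∈ S) (hstar : ∀ x ∈ S, star x ∈ S) :
    ((NonUnitalStarAlgebra.adjoin ℂ S).topologicalClosure : Set C) =
      closure (Submodule.span ℂ S : Set C) := by
  have h1 : S ∪ star S = S := Set.union_eq_left.2 fun x hx => by
    simpa using hstar _ hx
  have h2 : (Subsemigroup.closure S : Set C) = S :=
    congrArg SetLike.coe (Subsemigroup.closure_eq ⟨S, fun {x y} hx hy => hmul x hx y hy⟩)
  have h3 := NonUnitalStarAlgebra.adjoin_eq_span (R := ℂ) S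
  rw [h1, h2] at h3
  rw [← h3]
  rfl

/-- Let `S` be a star-closed multiplicative set of pairs whose span lies in a closed set in which
the first coordinate vanishes exactly when the second one does. Then the C⋆-algebras generated by
the two coordinates of `S` are isomorphic. -/
theorem NonUnitalStarAlgebra.exists_starAlgEquiv_of_graph {C C' : Type*}
    [NonUnitalCStarAlgebra C] [NonUnitalCStarAlgebra C'] (S P : Set (C × C'))
    (hmul : ∀ p ∈ S, ∀ q ∈ S, (p.1 * q.1, p.2 * q.2) ∈ S)
    (hstar : ∀ p ∈ S, (star p.1, star p.2) ∈ S)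
    (hP : IsClosed P) (hSP : (Submodule.span ℂ S : Set (C × C')) ⊆ P)
    (h0 : ∀ p ∈ P, p.1 = 0 ↔ p.2 = 0)
    (A : NonUnitalStarSubalgebra ℂ C) (A' : NonUnitalStarSubalgebra ℂ C')
    (hA : A = (NonUnitalStarAlgebra.adjoin ℂ (Prod.fst '' S)).topologicalClosure)
    (hA' : A' = (NonUnitalStarAlgebra.adjoin ℂ (Prod.snd '' S)).topologicalClosure) :
    ∃ e : A ≃⋆ₐ[ℂ] A', ∀ p ∈ S, ∀ a : A, (a : C) = p.1 → (e a : C') = p.2 := by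
  subst hA hA'
  have hS : ∀ d ∈ (NonUnitalStarAlgebra.adjoin ℂ S).topologicalClosure, d.1 = 0 ↔ d.2 = 0 := by
    intro d hd
    rw [← SetLike.mem_coe, NonUnitalStarAlgebra.coe_topologicalClosure_adjoin hmul hstar] at hd
    exact h0 d (closure_minimal hSP hP hd)
  obtain ⟨e₁, he₁⟩ := NonUnitalStarAlgebra.exists_starAlgEquiv_of_injOn
    (NonUnitalStarAlgHom.fst ℂ C C') S fun d hd h => Prod.ext h ((hS d hd).1 h)
  obtain ⟨e₂, he₂⟩ := NonUnitalStarAlgebra.exists_starAlgEquiv_of_injOn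
    (NonUnitalStarAlgHom.snd ℂ C C') S fun d hd h => Prod.ext ((hS d hd).2 h) h
  -- The C⋆-algebra generated by `S` projects isomorphically to both factors, so it is the graph of
  -- an isomorphism.
  refine ⟨e₁.symm.trans e₂, fun p hp a ha => ?_⟩
  have hpD := NonUnitalStarSubalgebra.le_topologicalClosure _
    (NonUnitalStarAlgebra.subset_adjoin ℂ S hp)
  have : e₁ ⟨p, hpD⟩ = a := Subtype.ext ((he₁ _).trans ha.symm)
  rw [← this]
  change (e₂ (e₁.symm (e₁ _)) : C') = _
  rw [StarAlgEquiv.symm_apply_apply]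
  exact he₂ ⟨p, hpD⟩

/-! ### Operators on `ℓ²(K, H)` -/

section Operators

variable {K : Type*} {H : Type*} [NormedAddCommGroup H] [InnerProductSpace ℂ H]
theorem EllTwo.operator_ext {S T : EllTwo K H →L[ℂ] EllTwo K H} (h : ∀ ξ k, S ξ k = T ξ k) :
    S = T :=
  ContinuousLinearMap.ext fun ξ => lp.ext (funext (h ξ))

variable [Group K] {B : Type*} [NonUnitalCStarAlgebra B]

theorem regularUnitary_apply (σ : K → K → Circle) (k : K) (ξ : EllTwo K H) (h : K) :
    regularUnitary H σ k ξ h = (σ k (k⁻¹ * h) : ℂ) • ξ (k⁻¹ * h) :=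
  rfl

variable {σ : K → K → Circle}

theorem regularUnitary_mul
    (hσ : ∀ k l m, σ l m * σ k (l * m) = σ (k * l) m * σ k l) (k l : K) :
    regularUnitary H σ k * regularUnitary H σ l =
      (σ k l : ℂ) • regularUnitary H σ (k * l) := by
  refine EllTwo.operator_ext fun ξ h => ?_
  have h1 := hσ k l (l⁻¹ * (k⁻¹ * h))
  rw [mul_inv_cancel_left] at h1
  change (σ k (k⁻¹ * h) : ℂ) • (σ l (l⁻¹ * (k⁻¹ * h)) : ℂ) • ξ (l⁻¹ * (k⁻¹ * h)) =
    (σ k l : ℂ) • (σ (k * l) ((k * l)⁻¹ * h) : ℂ) • ξ ((k * l)⁻¹ * h)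
  rw [smul_smul, smul_smul, mul_inv_rev, mul_assoc, ← Circle.coe_mul, ← Circle.coe_mul,
    mul_comm (σ k _), h1, mul_comm (σ k l)]

theorem regularUnitary_one (hσ₁ : IsNormalizedCochain₂ σ) :
    regularUnitary H σ 1 = 1 := by
  refine EllTwo.operator_ext fun ξ h => ?_
  rw [regularUnitary_apply, hσ₁ _ _ (Or.inl rfl)]
  simp

variable [CompleteSpace H]

theorem star_regularUnitary_mul_self (k : K) :
    star (regularUnitary H σ k) * regularUnitary H σ k = 1 := by
  refine (ContinuousLinearMap.norm_map_iff_adjoint_comp_self _).1 fun ξ => ?_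
  have h2 : (0 : ℝ) < (2 : ENNReal).toReal := by norm_num
  rw [lp.norm_eq_tsum_rpow h2, lp.norm_eq_tsum_rpow h2]
  congr 1
  simp only [regularUnitary_apply, norm_smul, Circle.norm_coe, one_mul]
  exact (Equiv.mulLeft k⁻¹).tsum_eq fun h => ‖ξ h‖ ^ (2 : ENNReal).toReal

/-- The adjoint is a left inverse because `u_k` is isometric, the right-hand side is a right inverse
by the cocycle identity, and the two must agree. -/
theorem star_regularUnitary (hσ₁ : IsNormalizedCochain₂ σ)
    (hσ : ∀ k l m, σ l m * σ k (l * m) = σ (k * l) m * σ k l) (k : K) :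
    star (regularUnitary H σ k) = ((σ k k⁻¹)⁻¹ : Circle) • regularUnitary H σ k⁻¹ := by
  have h : regularUnitary H σ k * (((σ k k⁻¹)⁻¹ : Circle) • regularUnitary H σ k⁻¹) = 1 := by
    rw [mul_smul_comm, regularUnitary_mul hσ, mul_inv_cancel, regularUnitary_one hσ₁]
    change _ • (σ k k⁻¹ • (1 : EllTwo K H →L[ℂ] EllTwo K H)) = 1
    rw [smul_smul, inv_mul_cancel, one_smul]
  exact left_inv_eq_right_inv (star_regularUnitary_mul_self k) h

theorem regularUnitary_mul_star_self (hσ₁ : IsNormalizedCochain₂ σ)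
    (hσ : ∀ k l m, σ l m * σ k (l * m) = σ (k * l) m * σ k l) (k : K) :
    regularUnitary H σ k * star (regularUnitary H σ k) = 1 := by
  rw [star_regularUnitary hσ₁ hσ, mul_smul_comm, regularUnitary_mul hσ, mul_inv_cancel,
    regularUnitary_one hσ₁]
  change _ • (σ k k⁻¹ • (1 : EllTwo K H →L[ℂ] EllTwo K H)) = 1
  rw [smul_smul, inv_mul_cancel, one_smul]

variable (φ : B →⋆ₙₐ[ℂ] (H →L[ℂ] H)) (π : K →* (B ≃⋆ₐ[ℂ] B))

theorem regularCoeff_apply (a : B) (ξ : EllTwo K H) (h : K) :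
    regularCoeff φ π a ξ h = φ ((π h)⁻¹ a) (ξ h) :=
  rfl

theorem regularCoeff_mul (a b : B) :
    regularCoeff φ π (a * b) = regularCoeff φ π a * regularCoeff φ π b :=
  EllTwo.operator_ext fun ξ h => by
    change φ ((π h)⁻¹ (a * b)) (ξ h) = φ ((π h)⁻¹ a) (φ ((π h)⁻¹ b) (ξ h))
    rw [map_mul, map_mul]; rfl

theorem regularCoeff_smul (z : ℂ) (a : B) :
    regularCoeff φ π (z • a) = z • regularCoeff φ π a :=
  EllTwo.operator_ext fun ξ h => by
    change φ ((π h)⁻¹ (z • a)) (ξ h) = z • φ ((π h)⁻¹ a) (ξ h)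
    rw [map_smul, map_smul]; rfl

theorem star_regularCoeff (a : B) :
    star (regularCoeff φ π a) = regularCoeff φ π (star a) := by
  symm
  rw [ContinuousLinearMap.star_eq_adjoint, ContinuousLinearMap.eq_adjoint_iff]
  intro ξ η
  rw [lp.inner_eq_tsum, lp.inner_eq_tsum]
  congr 1
  funext h
  rw [regularCoeff_apply, regularCoeff_apply, map_star, map_star,
    ContinuousLinearMap.star_eq_adjoint, ContinuousLinearMap.adjoint_inner_left]

theorem regularUnitary_mul_regularCoeff (k : K) (a : B) :
    regularUnitary H σ k * regularCoeff φ π a =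
      regularCoeff φ π (π k a) * regularUnitary H σ k :=
  EllTwo.operator_ext fun ξ h => by
    change (σ k (k⁻¹ * h) : ℂ) • φ ((π (k⁻¹ * h))⁻¹ a) (ξ (k⁻¹ * h)) =
      φ ((π h)⁻¹ (π k a)) ((σ k (k⁻¹ * h) : ℂ) • ξ (k⁻¹ * h))
    rw [map_smul, ← map_inv, ← map_inv, mul_inv_rev, inv_inv, map_mul]
    rfl

/-- The operator `a u_k` on `ℓ²(K, H)`. -/
noncomputable def regularMonomial (σ : K → K → Circle) (a : B) (k : K) :
    EllTwo K H →L[ℂ] EllTwo K H :=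
  regularCoeff φ π a * regularUnitary H σ k

theorem smul_regularMonomial (z : ℂ) (a : B) (k : K) :
    z • regularMonomial φ π σ a k = regularMonomial φ π σ (z • a) k := by
  rw [regularMonomial, regularMonomial, regularCoeff_smul, smul_mul_assoc]

theorem regularMonomial_mul (hσ : ∀ k l m, σ l m * σ k (l * m) = σ (k * l) m * σ k l)
    (a b : B) (k l : K) :
    regularMonomial φ π σ a k * regularMonomial φ π σ b l =
      (σ k l : ℂ) • regularMonomial φ π σ (a * π k b) (k * l) := by
  simp only [regularMonomial, regularCoeff_mul]
  rw [mul_assoc, ← mul_assoc (regularUnitary H σ k), regularUnitary_mul_regularCoeff, mul_assoc,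
    regularUnitary_mul hσ, mul_smul_comm, mul_smul_comm, mul_assoc]

theorem star_regularMonomial (hσ₁ : IsNormalizedCochain₂ σ)
    (hσ : ∀ k l m, σ l m * σ k (l * m) = σ (k * l) m * σ k l) (a : B) (k : K) :
    star (regularMonomial φ π σ a k) =
      (((σ k k⁻¹)⁻¹ : Circle) : ℂ) • regularMonomial φ π σ (π k⁻¹ (star a)) k⁻¹ := by
  rw [regularMonomial, star_mul, star_regularUnitary hσ₁ hσ, star_regularCoeff, smul_mul_assoc,
    regularUnitary_mul_regularCoeff]
  rfl

theorem regularUnitary_mul_regularMonomial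
    (hσ : ∀ k l m, σ l m * σ k (l * m) = σ (k * l) m * σ k l) (k : K) (a : B) (l : K) :
    regularUnitary H σ k * regularMonomial φ π σ a l =
      (σ k l : ℂ) • regularMonomial φ π σ (π k a) (k * l) := by
  rw [regularMonomial, ← mul_assoc, regularUnitary_mul_regularCoeff, mul_assoc,
    regularUnitary_mul hσ, mul_smul_comm, regularMonomial]

theorem regularMonomial_mul_regularUnitary
    (hσ : ∀ k l m, σ l m * σ k (l * m) = σ (k * l) m * σ k l) (a : B) (l k : K) :
    regularMonomial φ π σ a l * regularUnitary H σ k =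
      (σ l k : ℂ) • regularMonomial φ π σ a (l * k) := by
  rw [regularMonomial, mul_assoc, regularUnitary_mul hσ, mul_smul_comm, regularMonomial]

end Operators

/-! ### Automorphisms of the reduced twisted crossed product -/

section Automorphism

variable {K : Type*} {H : Type*} [NormedAddCommGroup H] [InnerProductSpace ℂ H]

open Classical in
/-- The matrix entry of an operator on `ℓ²(K, H)`, as an operator on `H`. -/
noncomputable def EllTwo.entry (h l : K) (T : EllTwo K H →L[ℂ] EllTwo K H) : H →L[ℂ] H :=
  (lp.evalCLM ℂ (fun _ : K => H) 2 h).comp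
    (T.comp (lp.singleContinuousLinearMap ℂ (fun _ : K => H) 2 l))

theorem EllTwo.continuous_entry (h l : K) :
    Continuous (EllTwo.entry h l : (EllTwo K H →L[ℂ] EllTwo K H) → (H →L[ℂ] H)) := by
  unfold EllTwo.entry
  fun_prop

theorem EllTwo.entry_add (h l : K) (S T : EllTwo K H →L[ℂ] EllTwo K H) :
    EllTwo.entry h l (S + T) = EllTwo.entry h l S + EllTwo.entry h l T :=
  rfl

theorem EllTwo.entry_smul (h l : K) (z : ℂ) (T : EllTwo K H →L[ℂ] EllTwo K H) :
    EllTwo.entry h l (z • T) = z • EllTwo.entry h l T :=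
  rfl

theorem EllTwo.entry_zero (h l : K) :
    EllTwo.entry h l (0 : EllTwo K H →L[ℂ] EllTwo K H) = 0 :=
  rfl

theorem EllTwo.eq_zero_of_entry {T : EllTwo K H →L[ℂ] EllTwo K H}
    (hT : ∀ h l, EllTwo.entry h l T = 0) : T = 0 := by
  classical
  refine lp.ext_continuousLinearMap (𝕜 := ℂ) (by norm_num) fun l => ?_
  refine ContinuousLinearMap.ext fun v => lp.ext (funext fun h => ?_)
  have h1 := DFunLike.congr_fun (hT h l) v
  convert! h1

variable [Group K] [CompleteSpace H] {B : Type*} [NonUnitalCStarAlgebra B]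
variable (φ : B →⋆ₙₐ[ℂ] (H →L[ℂ] H)) (π : K →* (B ≃⋆ₐ[ℂ] B)) (σ : K → K → Circle)

/-- A monomial is a weighted permutation matrix: column `l` has its only possibly nonzero entry in
row `kl`. The scalar sits inside `φ` so that entries visibly lie in the range of `φ`. -/
theorem entry_regularMonomial_mul (a : B) (k l : K) :
    EllTwo.entry (k * l) l (regularMonomial φ π σ a k) =
      φ ((σ k l : ℂ) • (π (k * l))⁻¹ a) := by
  classical
  refine ContinuousLinearMap.ext fun v => ?_
  change φ ((π (k * l))⁻¹ a)
    ((σ k (k⁻¹ * (k * l)) : ℂ) • (lp.single 2 l v : EllTwo K H) (k⁻¹ * (k * l))) = _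
  rw [inv_mul_cancel_left, lp.single_apply_self, map_smul, map_smul]
  rfl

theorem entry_regularMonomial_of_ne (a : B) {k l h : K} (hne : h ≠ k * l) :
    EllTwo.entry h l (regularMonomial φ π σ a k) = 0 := by
  classical
  refine ContinuousLinearMap.ext fun v => ?_
  change φ ((π h)⁻¹ a) ((σ k (k⁻¹ * h) : ℂ) • (lp.single 2 l v : EllTwo K H) (k⁻¹ * h)) = 0
  rw [lp.single_apply_ne, smul_zero, map_zero]
  exact fun h' => hne (by rw [← h', mul_inv_cancel_left])

/-- The monomials `a u_k`. -/
def regularMonomials : Set (EllTwo K H →L[ℂ] EllTwo K H) :=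
  {x | ∃ (a : B) (k : K), x = regularMonomial φ π σ a k}

theorem reducedTwistedCrossedProduct_eq :
    reducedTwistedCrossedProduct φ π σ =
      (NonUnitalStarAlgebra.adjoin ℂ (regularMonomials φ π σ)).topologicalClosure :=
  rfl

variable {φ π σ}

theorem coe_reducedTwistedCrossedProduct (hσ₁ : IsNormalizedCochain₂ σ)
    (hσ : ∀ k l m, σ l m * σ k (l * m) = σ (k * l) m * σ k l) :
    (reducedTwistedCrossedProduct φ π σ : Set (EllTwo K H →L[ℂ] EllTwo K H)) =
      closure (Submodule.span ℂ (regularMonomials φ π σ)) := by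
  refine NonUnitalStarAlgebra.coe_topologicalClosure_adjoin ?_ ?_
  · rintro _ ⟨a, k, rfl⟩ _ ⟨b, l, rfl⟩
    have h := regularMonomial_mul φ π hσ a b k l
    rw [smul_regularMonomial] at h
    exact ⟨_, _, h⟩
  · rintro _ ⟨a, k, rfl⟩
    have h := star_regularMonomial φ π hσ₁ hσ a k
    rw [smul_regularMonomial] at h
    exact ⟨_, _, h⟩

variable (φ π σ)

/-- The pairs `(a u_k, χ(k) β(a) u_{θ k})`. -/
def crossedGraph (β : B ≃⋆ₐ[ℂ] B) (θ : K ≃* K) (χ : K → Circle) :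
    Set ((EllTwo K H →L[ℂ] EllTwo K H) × (EllTwo K H →L[ℂ] EllTwo K H)) :=
  {p | ∃ (a : B) (k : K), p = (regularMonomial φ π σ a k,
    (χ k : ℂ) • regularMonomial φ π σ (β a) (θ k))}

theorem image_fst_crossedGraph (β : B ≃⋆ₐ[ℂ] B) (θ : K ≃* K) (χ : K → Circle) :
    Prod.fst '' crossedGraph φ π σ β θ χ = regularMonomials φ π σ := by
  ext x
  constructor
  · rintro ⟨_, ⟨a, k, rfl⟩, rfl⟩
    exact ⟨a, k, rfl⟩
  · rintro ⟨a, k, rfl⟩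
    exact ⟨_, ⟨a, k, rfl⟩, rfl⟩

theorem image_snd_crossedGraph (β : B ≃⋆ₐ[ℂ] B) (θ : K ≃* K) (χ : K → Circle) :
    Prod.snd '' crossedGraph φ π σ β θ χ = regularMonomials φ π σ := by
  ext x
  constructor
  · rintro ⟨_, ⟨a, k, rfl⟩, rfl⟩
    exact ⟨(χ k : ℂ) • β a, θ k, smul_regularMonomial φ π _ _ _⟩
  · rintro ⟨a, k, rfl⟩
    refine ⟨_, ⟨β.symm ((((χ (θ.symm k))⁻¹ : Circle) : ℂ) • a), θ.symm k, rfl⟩, ?_⟩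
    change (χ (θ.symm k) : ℂ) • regularMonomial φ π σ _ _ = _
    rw [StarAlgEquiv.apply_symm_apply, ← smul_regularMonomial, smul_smul, ← Circle.coe_mul,
      mul_inv_cancel, Circle.coe_one, one_smul, θ.apply_symm_apply]

variable {φ π σ} {β : B ≃⋆ₐ[ℂ] B} {θ : K ≃* K} {χ : K → Circle}

theorem crossedGraph_mul (hσ : ∀ k l m, σ l m * σ k (l * m) = σ (k * l) m * σ k l)
    (hβ : ∀ k b, π (θ k) (β b) = β (π k b))
    (hχ : ∀ k l, χ (k * l) * σ k l = χ k * χ l * σ (θ k) (θ l)) :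
    ∀ x ∈ crossedGraph φ π σ β θ χ, ∀ y ∈ crossedGraph φ π σ β θ χ,
      (x.1 * y.1, x.2 * y.2) ∈ crossedGraph φ π σ β θ χ := by
  rintro _ ⟨a, k, rfl⟩ _ ⟨b, l, rfl⟩
  refine ⟨(σ k l : ℂ) • (a * π k b), k * l, Prod.ext ?_ ?_⟩
  · rw [regularMonomial_mul φ π hσ, smul_regularMonomial]
  · change (χ k : ℂ) • regularMonomial φ π σ (β a) (θ k) *
        (χ l : ℂ) • regularMonomial φ π σ (β b) (θ l) =
      (χ (k * l) : ℂ) • regularMonomial φ π σ (β ((σ k l : ℂ) • (a * π k b))) (θ (k * l))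
    rw [smul_mul_smul_comm, regularMonomial_mul φ π hσ, smul_smul, hβ, map_smul,
      ← smul_regularMonomial, smul_smul, map_mul, map_mul, ← Circle.coe_mul, ← Circle.coe_mul,
      ← Circle.coe_mul, hχ]

theorem crossedGraph_star (hσ₁ : IsNormalizedCochain₂ σ)
    (hσ : ∀ k l m, σ l m * σ k (l * m) = σ (k * l) m * σ k l)
    (hβ : ∀ k b, π (θ k) (β b) = β (π k b))
    (hχ : ∀ k l, χ (k * l) * σ k l = χ k * χ l * σ (θ k) (θ l)) :
    ∀ x ∈ crossedGraph φ π σ β θ χ, (star x.1, star x.2) ∈ crossedGraph φ π σ β θ χ := by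
  -- The relation at `(1, 1)` reads `χ 1 = χ 1 * χ 1`, as `σ` is normalized.
  have hχ₁ : χ 1 = 1 := by
    simpa [hσ₁ 1 1 (Or.inl rfl)] using hχ 1 1
  rintro _ ⟨a, k, rfl⟩
  refine ⟨(((σ k k⁻¹)⁻¹ : Circle) : ℂ) • π k⁻¹ (star a), k⁻¹, Prod.ext ?_ ?_⟩
  · rw [star_regularMonomial φ π hσ₁ hσ, smul_regularMonomial]
  · have h1 : (χ k)⁻¹ * (σ (θ k) (θ k⁻¹))⁻¹ = χ k⁻¹ * (σ k k⁻¹)⁻¹ := by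
      have h2 := hχ k k⁻¹
      rw [mul_inv_cancel, hχ₁, one_mul] at h2
      rw [h2, mul_inv, mul_inv, mul_right_comm, mul_left_comm, mul_assoc]
      simp [mul_comm]
    change star ((χ k : ℂ) • regularMonomial φ π σ (β a) (θ k)) =
      (χ k⁻¹ : ℂ) • regularMonomial φ π σ
        (β ((((σ k k⁻¹)⁻¹ : Circle) : ℂ) • π k⁻¹ (star a))) (θ k⁻¹)
    have h3 : star (χ k : ℂ) = ((χ k)⁻¹ : Circle) := (Circle.coe_inv_eq_conj (χ k)).symm
    rw [star_smul, star_regularMonomial φ π hσ₁ hσ, smul_smul, map_smul,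
      ← smul_regularMonomial, smul_smul, ← map_inv, ← map_star β, hβ, ← Circle.coe_mul, ← h1, h3,
      ← Circle.coe_mul]

/-- By `hχ`, the phase relating the two entries depends only on the position `(h, l)` and not on the
monomial, so the relation survives linear combinations. Equality of norms alone would not; hence the
witness `b`. -/
theorem exists_entry_eq_of_mem_span_crossedGraph
    (hβ : ∀ k b, π (θ k) (β b) = β (π k b))
    (hχ : ∀ k l, χ (k * l) * σ k l = χ k * χ l * σ (θ k) (θ l)) (h l : K)
    {p : (EllTwo K H →L[ℂ] EllTwo K H) × (EllTwo K H →L[ℂ] EllTwo K H)}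
    (hp : p ∈ Submodule.span ℂ (crossedGraph φ π σ β θ χ)) :
    ∃ b : B, EllTwo.entry h l p.1 = φ b ∧
      EllTwo.entry (θ h) (θ l) p.2 = ((χ h * (χ l)⁻¹ : Circle) : ℂ) • φ (β b) := by
  have hβ' : ∀ k b, (π (θ k))⁻¹ (β b) = β ((π k)⁻¹ b) := fun k b => by
    rw [← map_inv, ← map_inv, ← map_inv, hβ]
  induction hp using Submodule.span_induction with
  | mem p hp =>
    obtain ⟨a, k, rfl⟩ := hp
    dsimp only
    by_cases hkl : h = k * l
    · subst hkl
      refine ⟨_, entry_regularMonomial_mul φ π σ a k l, ?_⟩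
      have h1 : χ k * σ (θ k) (θ l) = χ (k * l) * (χ l)⁻¹ * σ k l := by
        rw [mul_right_comm, hχ, mul_right_comm, mul_inv_cancel_right]
      rw [EllTwo.entry_smul, map_mul θ, entry_regularMonomial_mul, ← map_mul θ, hβ', map_smul,
        map_smul, map_smul, smul_smul, smul_smul, ← Circle.coe_mul, ← Circle.coe_mul, h1]
    · have hkl' : θ h ≠ θ k * θ l := fun h' => hkl (θ.injective (by rw [h', map_mul]))
      refine ⟨0, ?_, ?_⟩
      · rw [entry_regularMonomial_of_ne φ π σ a hkl, map_zero]
      · rw [EllTwo.entry_smul, entry_regularMonomial_of_ne φ π σ _ hkl', map_zero, map_zero,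
          smul_zero, smul_zero]
  | zero =>
    refine ⟨0, ?_, ?_⟩
    · rw [map_zero]; rfl
    · rw [map_zero, map_zero, smul_zero]; rfl
  | add p q _ _ hp hq =>
    obtain ⟨b, hb₁, hb₂⟩ := hp
    obtain ⟨d, hd₁, hd₂⟩ := hq
    refine ⟨b + d, ?_, ?_⟩
    · rw [Prod.fst_add, EllTwo.entry_add, hb₁, hd₁, map_add]
    · rw [Prod.snd_add, EllTwo.entry_add, hb₂, hd₂, map_add, map_add, smul_add]
  | smul z p _ hp =>
    obtain ⟨b, hb₁, hb₂⟩ := hp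
    refine ⟨z • b, ?_, ?_⟩
    · rw [Prod.smul_fst, EllTwo.entry_smul, hb₁, map_smul]
    · rw [Prod.smul_snd, EllTwo.entry_smul, hb₂, map_smul, map_smul, smul_comm]

/-- An automorphism `β` of `B` and an automorphism `θ` of `K` that are compatible with the action,
together with a function `χ` whose coboundary is `σ / θ^* σ`, induce the automorphism
`a u_k ↦ χ(k) β(a) u_{θ k}` of the reduced twisted crossed product. -/
theorem exists_crossedProduct_starAlgEquiv (hφ : Function.Injective φ)
    (hσ₁ : IsNormalizedCochain₂ σ)
    (hσ : ∀ k l m, σ l m * σ k (l * m) = σ (k * l) m * σ k l)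
    (hβ : ∀ k b, π (θ k) (β b) = β (π k b))
    (hχ : ∀ k l, χ (k * l) * σ k l = χ k * χ l * σ (θ k) (θ l)) :
    ∃ e : reducedTwistedCrossedProduct φ π σ ≃⋆ₐ[ℂ] reducedTwistedCrossedProduct φ π σ,
      ∀ a k (x : reducedTwistedCrossedProduct φ π σ),
        (x : EllTwo K H →L[ℂ] EllTwo K H) = regularMonomial φ π σ a k →
        (e x : EllTwo K H →L[ℂ] EllTwo K H) =
          regularMonomial φ π σ ((χ k : ℂ) • β a) (θ k) := by
  -- Equality of entry norms follows on the span because `φ` and `β` are isometric. Being a closed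
  -- condition it passes to limits, and it still forces the two coordinates to vanish together.
  have hclosed : IsClosed {p : (EllTwo K H →L[ℂ] EllTwo K H) × (EllTwo K H →L[ℂ] EllTwo K H) |
      ∀ h l, ‖EllTwo.entry (θ h) (θ l) p.2‖ = ‖EllTwo.entry h l p.1‖} := by
    simp only [Set.ofPred_forall]
    exact isClosed_iInter fun h => isClosed_iInter fun l =>
      isClosed_eq ((EllTwo.continuous_entry _ _).comp continuous_snd).norm
        ((EllTwo.continuous_entry _ _).comp continuous_fst).norm
  obtain ⟨e, he⟩ := NonUnitalStarAlgebra.exists_starAlgEquiv_of_graph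
    (crossedGraph φ π σ β θ χ) _ (crossedGraph_mul hσ hβ hχ) (crossedGraph_star hσ₁ hσ hβ hχ)
    hclosed (fun p hp h l => by
      obtain ⟨b, hb₁, hb₂⟩ := exists_entry_eq_of_mem_span_crossedGraph hβ hχ h l hp
      rw [hb₁, hb₂, norm_smul, Circle.norm_coe, one_mul, NonUnitalStarAlgHom.norm_map φ hφ,
        NonUnitalStarAlgHom.norm_map φ hφ, StarAlgEquiv.norm_map β b])
    (fun p hn => by
      constructor
      · intro h0
        refine EllTwo.eq_zero_of_entry fun h l => ?_
        have h1 := hn (θ.symm h) (θ.symm l)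
        rw [h0, EllTwo.entry_zero, norm_zero, θ.apply_symm_apply, θ.apply_symm_apply] at h1
        exact norm_eq_zero.1 h1
      · intro h0
        refine EllTwo.eq_zero_of_entry fun h l => ?_
        have h1 := hn h l
        rw [h0, EllTwo.entry_zero, norm_zero] at h1
        exact norm_eq_zero.1 h1.symm)
    (reducedTwistedCrossedProduct φ π σ) (reducedTwistedCrossedProduct φ π σ)
    (by rw [image_fst_crossedGraph, reducedTwistedCrossedProduct_eq])
    (by rw [image_snd_crossedGraph, reducedTwistedCrossedProduct_eq])
  exact ⟨e, fun a k x hx => (he _ ⟨a, k, rfl⟩ x hx).trans (smul_regularMonomial φ π _ _ _)⟩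

end Automorphism

/-! ### Multipliers of the reduced twisted crossed product -/

theorem DoubleCentralizer.ext_apply {A : Type*} [NonUnitalCStarAlgebra A] {m n : 𝓜(ℂ, A)}
    (h₁ : ∀ x, m.fst x = n.fst x) (h₂ : ∀ x, m.snd x = n.snd x) : m = n :=
  DoubleCentralizer.ext _ _ _ _
    (Prod.ext (ContinuousLinearMap.ext h₁) (ContinuousLinearMap.ext h₂))

theorem multiplierExtend_star {A : Type*} [NonUnitalCStarAlgebra A] (α : A ≃⋆ₐ[ℂ] A)
    (m : 𝓜(ℂ, A)) : multiplierExtend α (star m) = star (multiplierExtend α m) := by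
  refine DoubleCentralizer.ext_apply (fun x => ?_) fun x => ?_
  · rw [DoubleCentralizer.star_fst]
    change α ((star m).fst (α.symm x)) = star (α (m.snd (α.symm (star x))))
    rw [DoubleCentralizer.star_fst, map_star α, map_star α.symm]
  · rw [DoubleCentralizer.star_snd]
    change α ((star m).snd (α.symm x)) = star (α (m.fst (α.symm (star x))))
    rw [DoubleCentralizer.star_snd, map_star α, map_star α.symm]

theorem star_circle_mul_self (z : Circle) : star (z : ℂ) * z = 1 := by
  have h : star (z : ℂ) = (z⁻¹ : Circle) := (Circle.coe_inv_eq_conj z).symm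
  rw [h, ← Circle.coe_mul, inv_mul_cancel, Circle.coe_one]

section SubalgebraMultiplier

variable {C : Type*} [NonUnitalCStarAlgebra C] {A : NonUnitalStarSubalgebra ℂ C} [IsClosed (A : Set C)]

/-- The multiplier of a closed subalgebra given by an element `u` that multiplies it into
itself. -/
noncomputable def subalgebraMultiplier (A : NonUnitalStarSubalgebra ℂ C) [IsClosed (A : Set C)]
    (u : C) (hu : ∀ x ∈ A, u * x ∈ A ∧ x * u ∈ A) : 𝓜(ℂ, A) where
  fst := LinearMap.mkContinuous
    { toFun := fun x => ⟨u * x, (hu x x.2).1⟩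
      map_add' := fun x y => Subtype.ext (mul_add u (x : C) y)
      map_smul' := fun z x => Subtype.ext (mul_smul_comm z u (x : C)) } ‖u‖
    fun x => norm_mul_le u (x : C)
  snd := LinearMap.mkContinuous
    { toFun := fun x => ⟨x * u, (hu x x.2).2⟩
      map_add' := fun x y => Subtype.ext (add_mul (x : C) y u)
      map_smul' := fun z x => Subtype.ext (smul_mul_assoc z (x : C) u) } ‖u‖
    fun x => (norm_mul_le (x : C) u).trans (mul_comm _ _).le
  central := fun x y => Subtype.ext (mul_assoc (x : C) u y)

variable {u v w : C} (hu : ∀ x ∈ A, u * x ∈ A ∧ x * u ∈ A)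
  (hv : ∀ x ∈ A, v * x ∈ A ∧ x * v ∈ A) (hw : ∀ x ∈ A, w * x ∈ A ∧ x * w ∈ A)

theorem coe_star_subalgebraMultiplier_fst (x : A) :
    ((star (subalgebraMultiplier A u hu)).fst x : C) = star u * x := by
  rw [DoubleCentralizer.star_fst]
  change star (star (x : C) * u) = _
  rw [star_mul, star_star]

theorem coe_star_subalgebraMultiplier_snd (x : A) :
    ((star (subalgebraMultiplier A u hu)).snd x : C) = x * star u := by
  rw [DoubleCentralizer.star_snd]
  change star (u * star (x : C)) = _
  rw [star_mul, star_star]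

/-- The ambient algebra may lack a unit, so unitarity is expressed through left multiplication; the
right-hand versions follow by taking adjoints. -/
theorem subalgebraMultiplier_mem_unitary (h₁ : ∀ x, star u * (u * x) = x)
    (h₂ : ∀ x, u * (star u * x) = x) :
    subalgebraMultiplier A u hu ∈ unitary 𝓜(ℂ, A) := by
  refine ⟨DoubleCentralizer.ext_apply (fun x => Subtype.ext ?_) fun x => Subtype.ext ?_,
    DoubleCentralizer.ext_apply (fun x => Subtype.ext ?_) fun x => Subtype.ext ?_⟩
  · refine (coe_star_subalgebraMultiplier_fst hu _).trans ?_
    change star u * (u * (x : C)) = x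
    exact h₁ _
  · refine (congrArg (· * u) (coe_star_subalgebraMultiplier_snd hu x)).trans ?_
    change (x : C) * star u * u = x
    simpa [mul_assoc] using congrArg star (h₁ (star (x : C)))
  · refine (congrArg (u * ·) (coe_star_subalgebraMultiplier_fst hu x)).trans ?_
    change u * (star u * (x : C)) = x
    exact h₂ _
  · refine (coe_star_subalgebraMultiplier_snd hu _).trans ?_
    change (x : C) * u * star u = x
    simpa [mul_assoc] using congrArg star (h₂ (star (x : C)))

theorem subalgebraMultiplier_mul {z : ℂ} (h : u * v = z • w) :
    subalgebraMultiplier A u hu * subalgebraMultiplier A v hv =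
      z • subalgebraMultiplier A w hw := by
  refine DoubleCentralizer.ext_apply (fun x => Subtype.ext ?_) fun x => Subtype.ext ?_
  · change u * (v * (x : C)) = z • (w * (x : C))
    rw [← mul_assoc, h, smul_mul_assoc]
  · change (x : C) * u * v = z • ((x : C) * w)
    rw [mul_assoc, h, mul_smul_comm]

theorem coe_mul_subalgebraMultiplier {x y : A} (h : (x : C) * u = u * y) :
    (x : 𝓜(ℂ, A)) * subalgebraMultiplier A u hu =
      subalgebraMultiplier A u hu * (y : 𝓜(ℂ, A)) := by
  refine DoubleCentralizer.ext_apply (fun z => Subtype.ext ?_) fun z => Subtype.ext ?_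
  · change (x : C) * (u * (z : C)) = u * ((y : C) * z)
    rw [← mul_assoc, h, mul_assoc]
  · change (z : C) * x * u = (z : C) * u * y
    rw [mul_assoc, h, mul_assoc]

theorem multiplierExtend_subalgebraMultiplier {e : A ≃⋆ₐ[ℂ] A}
    (h₁ : ∀ y : A, (e ⟨u * y, (hu y y.2).1⟩ : C) = v * e y)
    (h₂ : ∀ y : A, (e ⟨y * u, (hu y y.2).2⟩ : C) = e y * v) :
    multiplierExtend e (subalgebraMultiplier A u hu) = subalgebraMultiplier A v hv := by
  refine DoubleCentralizer.ext_apply (fun x => Subtype.ext ?_) fun x => Subtype.ext ?_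
  · change (e ⟨u * (e.symm x : C), _⟩ : C) = v * (x : C)
    rw [h₁, e.apply_symm_apply]
  · change (e ⟨(e.symm x : C) * u, _⟩ : C) = (x : C) * v
    rw [h₂, e.apply_symm_apply]

/-- Automorphisms of a closed subalgebra `A` and unitaries that multiply `A` into itself define an
anomalous action if they satisfy its relations as elements of the ambient algebra. -/
theorem exists_anomalousAction_of_unitaries {Q : Type*} [Group Q] (ω : Q → Q → Q → Circle)
    (α : Q → (A ≃⋆ₐ[ℂ] A)) (u : Q → Q → C)
    (hu : ∀ q r, ∀ x ∈ A, u q r * x ∈ A ∧ x * u q r ∈ A)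
    (hu₁ : ∀ q r x, star (u q r) * (u q r * x) = x)
    (hu₂ : ∀ q r x, u q r * (star (u q r) * x) = x)
    (hα : ∀ q r (x : A), (α q (α r x) : C) * u q r = u q r * α (q * r) x)
    (v : Q → Q → Q → C)
    (hv₁ : ∀ q r t (y : A), (α q ⟨u r t * y, (hu r t y y.2).1⟩ : C) = v q r t * α q y)
    (hv₂ : ∀ q r t (y : A), (α q ⟨y * u r t, (hu r t y y.2).2⟩ : C) = α q y * v q r t)
    (huv : ∀ q r t, u q r * u (q * r) t = (ω q r t : ℂ) • (v q r t * u q (r * t))) :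
    ∃ F : AnomalousAction ω A, (∀ q, F.α q = α q) ∧
      ∀ q r (x : A), ((F.m q r).fst x : C) = star (u q r) * x := by
  -- Every `x` in `A` is `α q y` for some `y`, and then `v x = α q (u y)`; similarly on the right.
  have hv : ∀ q r t, ∀ x ∈ A, v q r t * x ∈ A ∧ x * v q r t ∈ A := fun q r t x hx => by
    have h := (α q).apply_symm_apply ⟨x, hx⟩
    have h₁ := hv₁ q r t ((α q).symm ⟨x, hx⟩)
    have h₂ := hv₂ q r t ((α q).symm ⟨x, hx⟩)
    rw [h] at h₁ h₂
    exact ⟨h₁ ▸ SetLike.coe_mem _, h₂ ▸ SetLike.coe_mem _⟩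
  have hvu : ∀ q r t, ∀ x ∈ A, v q r t * u q (r * t) * x ∈ A ∧ x * (v q r t * u q (r * t)) ∈ A :=
    fun q r t x hx => ⟨by rw [mul_assoc]; exact (hv q r t _ (hu q (r * t) x hx).1).1,
      by rw [← mul_assoc]; exact (hu q (r * t) _ (hv q r t x hx).2).2⟩
  let M : Q → Q → 𝓜(ℂ, A) := fun q r => subalgebraMultiplier A (u q r) (hu q r)
  have hM : ∀ q r, M q r ∈ unitary 𝓜(ℂ, A) := fun q r =>
    subalgebraMultiplier_mem_unitary (hu q r) (hu₁ q r) (hu₂ q r)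
  -- The anomalous action uses the adjoints of the given unitaries; taking adjoints reverses the
  -- products in `huv` into the order of the associator relation.
  refine ⟨⟨α, fun q r => star (M q r), fun q r => Unitary.star_mem (hM q r), fun q r x => ?_,
    fun q r t => ?_⟩, fun q => rfl,
    fun q r x => coe_star_subalgebraMultiplier_fst (hu q r) x⟩
  · have h : (α q (α r x) : 𝓜(ℂ, A)) * M q r = M q r * (α (q * r) x : 𝓜(ℂ, A)) :=
      coe_mul_subalgebraMultiplier (hu q r) (hα q r x)
    rw [← mul_one (star (M q r) * _), ← (hM q r).2, mul_assoc (star (M q r)), ← mul_assoc _ (M q r),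
      h, ← mul_assoc, ← mul_assoc, (hM q r).1, one_mul]
  · have h₁ : M q r * M (q * r) t =
        (ω q r t : ℂ) • (multiplierExtend (α q) (M r t) * M q (r * t)) := by
      rw [multiplierExtend_subalgebraMultiplier (hu r t) (hv q r t) (hv₁ q r t) (hv₂ q r t),
        subalgebraMultiplier_mul (hu q r) (hu (q * r) t) (hvu q r t) (huv q r t),
        subalgebraMultiplier_mul (hv q r t) (hu q (r * t)) (hvu q r t)
          (one_smul ℂ (v q r t * u q (r * t))).symm, one_smul]
    have h₂ := congrArg star h₁
    have h₃ : (ω q r t : ℂ) * star (ω q r t : ℂ) = 1 := by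
      rw [mul_comm]; exact star_circle_mul_self _
    rw [star_mul, star_smul, star_mul, ← multiplierExtend_star] at h₂
    rw [h₂, smul_smul, h₃, one_smul]

/-- A `*`-automorphism of a closed subalgebra, as a map to the ambient algebra. -/
noncomputable def subalgebraEquivCLM (e : A ≃⋆ₐ[ℂ] A) : A →L[ℂ] C :=
  LinearMap.mkContinuous
    { toFun := fun x => (e x : C)
      map_add' := fun x y => congrArg Subtype.val (map_add e x y)
      map_smul' := fun z x => congrArg Subtype.val (map_smul e z x) } 1 fun x => by
        rw [one_mul]; exact (StarAlgEquiv.norm_map e x).le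

/-! ### Reduction to a densely spanning set -/

section DenseSpan

variable {S : Set C}

theorem subalgebra_hom_ext
    (hS : (A : Set C) = closure (Submodule.span ℂ S : Set C))
    {f g : A →L[ℂ] C}
    (h : ∀ x : A, (x : C) ∈ S → f x = g x) (x : A) : f x = g x := by
  have hSA : S ⊆ A := hS ▸ Submodule.subset_span.trans subset_closure
  -- The span lives in `C` while `f` and `g` are defined on `A` only, so the set where they agree is
  -- pushed into `C`. It stays closed because `A` is closed.
  have hle : Submodule.span ℂ S ≤
      (LinearMap.eqLocus f.toLinearMap g.toLinearMap).map A.toSubmodule.subtype :=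
    Submodule.span_le.2 fun y hy => ⟨⟨y, hSA hy⟩, h ⟨y, hSA hy⟩ hy, rfl⟩
  have hA : IsClosed (A : Set C) := inferInstance
  have hc : IsClosed ((↑) '' {x : A | f x = g x} : Set C) :=
    hA.isClosedEmbedding_subtypeVal.isClosedMap _ (isClosed_eq f.continuous g.continuous)
  have hx : (x : C) ∈ closure (Submodule.span ℂ S : Set C) := by
    rw [← hS]
    exact x.2
  obtain ⟨y, hy, hyx⟩ := closure_minimal (fun z hz => hle hz) hc hx
  obtain rfl := Subtype.ext hyx
  exact hy

theorem subalgebra_multiplies_of_dense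
    (hS : (A : Set C) = closure (Submodule.span ℂ S : Set C))
    (hu : ∀ x ∈ S, u * x ∈ A ∧ x * u ∈ A) : ∀ x ∈ A, u * x ∈ A ∧ x * u ∈ A := by
  have hA : IsClosed (A : Set C) := inferInstance
  intro x hx
  replace hx : x ∈ closure (Submodule.span ℂ S : Set C) := hS ▸ hx
  have hc₁ : IsClosed ((u * ·) ⁻¹' (A : Set C)) := hA.preimage (by fun_prop)
  have hc₂ : IsClosed ((· * u) ⁻¹' (A : Set C)) := hA.preimage (by fun_prop)
  refine closure_minimal (t := (u * ·) ⁻¹' (A : Set C) ∩ (· * u) ⁻¹' (A : Set C))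
    (fun y hy => ?_) (hc₁.inter hc₂) hx
  have hle : Submodule.span ℂ S ≤ A.toSubmodule.comap (LinearMap.mulLeft ℂ u) ⊓
      A.toSubmodule.comap (LinearMap.mulRight ℂ u) := Submodule.span_le.2 hu
  exact hle hy

theorem subalgebraEquiv_mul_left_ext
    (hS : (A : Set C) = closure (Submodule.span ℂ S : Set C))
    {e : A ≃⋆ₐ[ℂ] A}
    (h : ∀ y : A, (y : C) ∈ S → (e ⟨u * y, (hu y y.2).1⟩ : C) = v * e y) (y : A) :
    (e ⟨u * y, (hu y y.2).1⟩ : C) = v * e y :=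
  subalgebra_hom_ext hS
    (f := (subalgebraEquivCLM e).comp (subalgebraMultiplier A u hu).fst)
    (g := (ContinuousLinearMap.mul ℂ C v).comp (subalgebraEquivCLM e)) h y

theorem subalgebraEquiv_mul_right_ext
    (hS : (A : Set C) = closure (Submodule.span ℂ S : Set C))
    {e : A ≃⋆ₐ[ℂ] A}
    (h : ∀ y : A, (y : C) ∈ S → (e ⟨y * u, (hu y y.2).2⟩ : C) = e y * v) (y : A) :
    (e ⟨y * u, (hu y y.2).2⟩ : C) = e y * v :=
  subalgebra_hom_ext hS
    (f := (subalgebraEquivCLM e).comp (subalgebraMultiplier A u hu).snd)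
    (g := ((ContinuousLinearMap.mul ℂ C).flip v).comp (subalgebraEquivCLM e)) h y

theorem subalgebraEquiv_intertwine_ext
    (hS : (A : Set C) = closure (Submodule.span ℂ S : Set C))
    {e e' : A ≃⋆ₐ[ℂ] A}
    (h : ∀ y : A, (y : C) ∈ S → (e y : C) * u = u * e' y) (y : A) : (e y : C) * u = u * e' y :=
  subalgebra_hom_ext hS
    (f := ((ContinuousLinearMap.mul ℂ C).flip u).comp (subalgebraEquivCLM e))
    (g := (ContinuousLinearMap.mul ℂ C u).comp (subalgebraEquivCLM e')) h y

end DenseSpan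

end SubalgebraMultiplier

/-! ### Algebras densely spanned by twisted covariant monomials -/

section CovariantMonomials

variable {C : Type*} [NonUnitalCStarAlgebra C]
variable {K : Type*} [Group K] {B : Type*} [NonUnitalCStarAlgebra B]

/-- The subalgebra `A` is densely spanned by monomials `M a k`, which multiply with the elements
`u k` like the operators `a u_k` of a twisted crossed product. -/
structure CovariantMonomials (A : NonUnitalStarSubalgebra ℂ C) (π : K →* (B ≃⋆ₐ[ℂ] B))
    (σ : K → K → Circle) (M : B → K → C) (u : K → C) : Prop where
  dense : (A : Set C) = closure (Submodule.span ℂ {x | ∃ (a : B) (k : K), x = M a k} : Set C)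
  smul : ∀ (z : ℂ) (a : B) (k : K), z • M a k = M (z • a) k
  unitary_mul : ∀ (k : K) (a : B) (l : K), u k * M a l = (σ k l : ℂ) • M (π k a) (k * l)
  mul_unitary : ∀ (a : B) (l k : K), M a l * u k = (σ l k : ℂ) • M a (l * k)

namespace CovariantMonomials

variable {A : NonUnitalStarSubalgebra ℂ C}
  {π : K →* (B ≃⋆ₐ[ℂ] B)} {σ : K → K → Circle} {M : B → K → C} {u : K → C}

theorem mem (h : CovariantMonomials A π σ M u) (a : B) (k : K) : M a k ∈ A := by
  rw [← SetLike.mem_coe, h.dense]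
  exact subset_closure (Submodule.subset_span ⟨a, k, rfl⟩)

variable [IsClosed (A : Set C)]

theorem multiplies (h : CovariantMonomials A π σ M u) (z : ℂ) (k : K) :
    ∀ x ∈ A, z • u k * x ∈ A ∧ x * z • u k ∈ A := by
  refine subalgebra_multiplies_of_dense h.dense ?_
  rintro _ ⟨a, l, rfl⟩
  rw [smul_mul_assoc, mul_smul_comm, h.unitary_mul, h.mul_unitary, h.smul, h.smul, h.smul, h.smul]
  exact ⟨h.mem _ _, h.mem _ _⟩

/-- With its right-handed counterpart, this identifies the image of the multiplier `z u_k` under the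
extension of `e` as `z χ(k) u_{θ k}`. -/
theorem equiv_unitary_mul (h : CovariantMonomials A π σ M u) {β : B ≃⋆ₐ[ℂ] B} {θ : K ≃* K}
    {χ : K → Circle} {e : A ≃⋆ₐ[ℂ] A} (hβ : ∀ k b, π (θ k) (β b) = β (π k b))
    (hχ : ∀ k l, χ (k * l) * σ k l = χ k * χ l * σ (θ k) (θ l))
    (he : ∀ a k (x : A), (x : C) = M a k → (e x : C) = M ((χ k : ℂ) • β a) (θ k)) (z : ℂ) (k : K)
    (y : A) :
    (e ⟨z • u k * y, (h.multiplies z k y y.2).1⟩ : C) = (z * χ k) • u (θ k) * e y := by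
  refine subalgebraEquiv_mul_left_ext (h.multiplies z k) h.dense (fun y hy => ?_) y
  obtain ⟨a, l, hal⟩ := hy
  have h₁ : z • u k * (y : C) = M ((z * σ k l) • π k a) (k * l) := by
    rw [hal, smul_mul_assoc, h.unitary_mul, smul_smul, h.smul]
  have hχ' : (χ (k * l) : ℂ) * σ k l = χ k * χ l * σ (θ k) (θ l) := by
    exact_mod_cast congrArg (fun w : Circle => (w : ℂ)) (hχ k l)
  rw [he _ _ _ h₁, he _ _ _ hal, smul_mul_assoc, h.unitary_mul, map_smul, map_smul, hβ, map_mul,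
    ← h.smul, ← h.smul, ← h.smul, smul_smul, smul_smul, smul_smul]
  congr 1
  linear_combination z * hχ'

theorem equiv_mul_unitary (h : CovariantMonomials A π σ M u) {β : B ≃⋆ₐ[ℂ] B} {θ : K ≃* K}
    {χ : K → Circle} {e : A ≃⋆ₐ[ℂ] A}
    (hχ : ∀ k l, χ (k * l) * σ k l = χ k * χ l * σ (θ k) (θ l))
    (he : ∀ a k (x : A), (x : C) = M a k → (e x : C) = M ((χ k : ℂ) • β a) (θ k)) (z : ℂ) (k : K)
    (y : A) :
    (e ⟨y * z • u k, (h.multiplies z k y y.2).2⟩ : C) = e y * (z * χ k) • u (θ k) := by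
  refine subalgebraEquiv_mul_right_ext (h.multiplies z k) h.dense (fun y hy => ?_) y
  obtain ⟨a, l, hal⟩ := hy
  have h₁ : (y : C) * z • u k = M ((z * σ l k) • a) (l * k) := by
    rw [hal, mul_smul_comm, h.mul_unitary, smul_smul, h.smul]
  have hχ' : (χ (l * k) : ℂ) * σ l k = χ l * χ k * σ (θ l) (θ k) := by
    exact_mod_cast congrArg (fun w : Circle => (w : ℂ)) (hχ l k)
  rw [he _ _ _ h₁, he _ _ _ hal, mul_smul_comm, h.mul_unitary, map_smul, map_mul,
    ← h.smul, ← h.smul, ← h.smul, smul_smul, smul_smul, smul_smul]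
  congr 1
  linear_combination z * hχ'

/-- If the automorphisms `e₁ ∘ e₂` and `e₃` agree on monomials up to conjugation by `u l`, then
they agree up to conjugation by `u l`. -/
theorem equiv_equiv_mul_unitary (h : CovariantMonomials A π σ M u)
    {β₁ β₂ β₃ : B ≃⋆ₐ[ℂ] B} {θ₁ θ₂ θ₃ : K ≃* K} {χ₁ χ₂ χ₃ : K → Circle} {e₁ e₂ e₃ : A ≃⋆ₐ[ℂ] A}
    (he₁ : ∀ a k (x : A), (x : C) = M a k → (e₁ x : C) = M ((χ₁ k : ℂ) • β₁ a) (θ₁ k))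
    (he₂ : ∀ a k (x : A), (x : C) = M a k → (e₂ x : C) = M ((χ₂ k : ℂ) • β₂ a) (θ₂ k))
    (he₃ : ∀ a k (x : A), (x : C) = M a k → (e₃ x : C) = M ((χ₃ k : ℂ) • β₃ a) (θ₃ k)) {l : K}
    (hβ : ∀ a, β₁ (β₂ a) = π l (β₃ a)) (hθ : ∀ k, θ₁ (θ₂ k) * l = l * θ₃ k)
    (hχ : ∀ k, χ₂ k * χ₁ (θ₂ k) * σ (θ₁ (θ₂ k)) l = χ₃ k * σ l (θ₃ k)) (z : ℂ) (x : A) :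
    (e₁ (e₂ x) : C) * z • u l = z • u l * e₃ x := by
  refine subalgebraEquiv_intertwine_ext h.dense (e := e₂.trans e₁) (fun y hy => ?_) x
  obtain ⟨a, k, hak⟩ := hy
  change (e₁ (e₂ y) : C) * _ = _
  have hχ' : (χ₂ k : ℂ) * χ₁ (θ₂ k) * σ (θ₁ (θ₂ k)) l = χ₃ k * σ l (θ₃ k) := by
    exact_mod_cast congrArg (fun w : Circle => (w : ℂ)) (hχ k)
  rw [he₁ _ _ _ (he₂ _ _ _ hak), he₃ _ _ _ hak, mul_smul_comm, smul_mul_assoc, h.mul_unitary,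
    h.unitary_mul, map_smul, map_smul, hβ, hθ, ← h.smul, ← h.smul, ← h.smul,
    smul_smul, smul_smul, smul_smul, smul_smul, smul_smul]
  congr 1
  linear_combination z * hχ'

end CovariantMonomials

end CovariantMonomials

/-! ### The anomalous action on the crossed product by the kernel -/

section KernelCrossedProduct

variable {Q G : Type*} [Group Q] [Group G]

/-- Conjugation by `g` as an automorphism of the kernel. -/
def kerConjEquiv (ρ : G →* Q) (g : G) : ρ.ker ≃* ρ.ker where
  toFun := kerConj ρ g
  invFun := kerConj ρ g⁻¹
  left_inv k := Subtype.ext (by simp [kerConj, mul_assoc])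
  right_inv k := Subtype.ext (by simp [kerConj, mul_assoc])
  map_mul' k l := Subtype.ext (by simp [kerConj, mul_assoc])

variable {ω : Q → Q → Q → Circle} {ρ : G →* Q} {c : G → G → Circle}

theorem isNormalizedCochain₂_restrictKer (hc : IsNormalizedCochain₂ c) :
    IsNormalizedCochain₂ (restrictKer ρ c) := fun k l h =>
  hc k l (h.imp (congrArg Subtype.val) (congrArg Subtype.val))

theorem restrictKer_cocycle (hω : IsNormalizedCochain₃ ω)
    (hdc : ∀ f g h : G, cochainD₂ c f g h = ω (ρ f) (ρ g) (ρ h)) (k l m : ρ.ker) :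
    restrictKer ρ c l m * restrictKer ρ c k (l * m) =
      restrictKer ρ c (k * l) m * restrictKer ρ c k l :=
  cochain_identity hω hdc k l m (Or.inl k.2)

variable {B : Type*} [NonUnitalCStarAlgebra B] {π : G →* (B ≃⋆ₐ[ℂ] B)}

theorem map_kerConj_apply (g : G) (k : ρ.ker) (b : B) :
    (π.comp ρ.ker.subtype) (kerConjEquiv ρ g k) (π g b) =
      π g ((π.comp ρ.ker.subtype) k b) := by
  change (π (g * k * g⁻¹) * π g) b = (π g * π k) b
  rw [← map_mul, ← map_mul, inv_mul_cancel_right]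

theorem conjScalar_cocycle (hω : IsNormalizedCochain₃ ω)
    (hdc : ∀ f g h : G, cochainD₂ c f g h = ω (ρ f) (ρ g) (ρ h)) (g : G) (k l : ρ.ker) :
    conjScalar c g (k * l : ρ.ker) * restrictKer ρ c k l =
      conjScalar c g k * conjScalar c g l *
        restrictKer ρ c (kerConjEquiv ρ g k) (kerConjEquiv ρ g l) :=
  conjScalar_mul_left hω hdc g k.2 l.2

/-- Let `A` be densely spanned by covariant monomials over the kernel of `ρ`, and let
automorphisms `α g` of `A` twist these monomials by conjugation with `g`. Then every section of
`ρ` defines an anomalous action. -/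
theorem exists_anomalousAction_of_covariantMonomials {C : Type*} [NonUnitalCStarAlgebra C]
    {A : NonUnitalStarSubalgebra ℂ C} [IsClosed (A : Set C)] {M : B → ρ.ker → C} {u : ρ.ker → C}
    (hω : IsNormalizedCochain₃ ω)
    (hdc : ∀ f g h : G, cochainD₂ c f g h = ω (ρ f) (ρ g) (ρ h))
    (hM : CovariantMonomials A (π.comp ρ.ker.subtype) (restrictKer ρ c) M u)
    (hu : ∀ k l, u k * u l = (restrictKer ρ c k l : ℂ) • u (k * l))
    (hu₁ : ∀ k x, star (u k) * (u k * x) = x) (hu₂ : ∀ k x, u k * (star (u k) * x) = x)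
    {α : G → (A ≃⋆ₐ[ℂ] A)}
    (hα : ∀ g a k (x : A), (x : C) = M a k →
      (α g x : C) = M ((conjScalar c g k : ℂ) • π g a) (kerConjEquiv ρ g k))
    (s : Q → G) (hs : ∀ q, ρ (s q) = q) :
    ∃ F : AnomalousAction ω A, (∀ q, F.α q = α (s q)) ∧
      ∀ q r (x : A), ((F.m q r).fst x : C) =
        (((c (s q) (s r))⁻¹ * c (sectionCocycle ρ s hs q r) (s (q * r)) : Circle) : ℂ) •
          (star (u (sectionCocycle ρ s hs q r)) * x) := by
  let γ := sectionCocycle ρ s hs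
  let z : Q → Q → Circle := fun q r => splitScalar c (s q) (s r) (γ q r) (s (q * r))
  have hsplit : ∀ q r, s q * s r = γ q r * s (q * r) := fun q r =>
    (inv_mul_cancel_right _ _).symm
  have hz₁ : ∀ q r, star (z q r : ℂ) * z q r = 1 := fun q r => star_circle_mul_self _
  have hz₂ : ∀ q r, (z q r : ℂ) * star (z q r : ℂ) = 1 := fun q r => by rw [mul_comm, hz₁]
  obtain ⟨F, hF₁, hF₂⟩ := exists_anomalousAction_of_unitaries ω (fun q => α (s q))
    (fun q r => (z q r : ℂ) • u (γ q r)) (fun q r => hM.multiplies _ _)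
    (fun q r x => by
      rw [star_smul, smul_mul_assoc, smul_mul_assoc, mul_smul_comm, smul_smul, hz₁, one_smul, hu₁])
    (fun q r x => by
      rw [star_smul, smul_mul_assoc, smul_mul_assoc, mul_smul_comm, smul_smul, hz₂, one_smul, hu₂])
    (fun q r x => by
      refine hM.equiv_equiv_mul_unitary (hα (s q)) (hα (s r)) (hα (s (q * r))) (fun a => ?_)
        (fun k => Subtype.ext ?_)
        (fun k => conjScalar_mul_conjScalar hω hdc (γ q r).2 (hsplit q r) k.2) _ x
      · change (π (s q) * π (s r)) a = (π (γ q r) * π (s (q * r))) a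
        rw [← map_mul, ← map_mul, hsplit]
      · change s q * (s r * k * (s r)⁻¹) * (s q)⁻¹ * γ q r =
          γ q r * (s (q * r) * k * (s (q * r))⁻¹)
        have h₁ : (γ q r : G) = s q * s r * (s (q * r))⁻¹ := rfl
        rw [h₁]
        group)
    -- The image of `z u_γ` for the pair `(r, t)` under the extension of `α (s q)` to multipliers.
    (fun q r t => ((z r t : ℂ) * conjScalar c (s q) (γ r t)) • u (kerConjEquiv ρ (s q) (γ r t)))
    (fun q r t y => hM.equiv_unitary_mul (map_kerConj_apply (s q))
      (conjScalar_cocycle hω hdc (s q)) (hα (s q)) _ _ y)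
    (fun q r t y => hM.equiv_mul_unitary (conjScalar_cocycle hω hdc (s q)) (hα (s q)) _ _ y)
    (fun q r t => by
      have h₄ : s q * s (r * t) = γ q (r * t) * s (q * r * t) := by
        rw [hsplit, mul_assoc q]
      have hl : γ q r * γ (q * r) t = kerConjEquiv ρ (s q) (γ r t) * γ q (r * t) := by
        refine Subtype.ext (mul_right_cancel (b := s (q * r * t)) ?_)
        change (γ q r : G) * γ (q * r) t * s (q * r * t) =
          s q * γ r t * (s q)⁻¹ * γ q (r * t) * s (q * r * t)
        rw [mul_assoc, ← hsplit, mul_assoc _ (γ q (r * t) : G), ← h₄, ← mul_assoc, ← hsplit]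
        simp [mul_assoc, hsplit r t]
      have h := congrArg (fun w : Circle => (w : ℂ)) (splitScalar_associator hω hdc (hsplit q r)
        (hsplit (q * r) t) (hsplit r t) h₄ (γ q r).2 (γ r t).2)
      simp only [Circle.coe_mul, hs] at h
      -- The two bracketings of `q r t` give the same section value only after rewriting by
      -- associativity.
      have h₅ : z q (r * t) = splitScalar c (s q) (s (r * t)) (γ q (r * t)) (s (q * r * t)) := by
        rw [mul_assoc q]
      rw [smul_mul_smul_comm, smul_mul_smul_comm, hu, hu, hl, smul_smul, smul_smul, smul_smul, h₅]
      refine congrArg (· • u _) (h.trans ?_)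
      change _ = _ * ((splitScalar c (s r) (s t) (γ r t) (s (r * t)) : ℂ) * _ * _) *
        (c (s q * γ r t * (s q)⁻¹) (γ q (r * t)) : ℂ)
      ring)
  refine ⟨F, hF₁, fun q r x => ?_⟩
  have hz' : (z q r)⁻¹ = (c (s q) (s r))⁻¹ * c (γ q r) (s (q * r)) := by
    change (c _ _ * (c _ _)⁻¹)⁻¹ = _
    rw [mul_inv, inv_inv]
  have hz : star (z q r : ℂ) = ((c (s q) (s r))⁻¹ * c (γ q r) (s (q * r)) : Circle) := by
    rw [← hz']
    exact (Circle.coe_inv_eq_conj _).symm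
  rw [hF₂, star_smul, hz, smul_mul_assoc]

end KernelCrossedProduct

/-! ### Application to the regular representation -/

theorem covariantMonomials_regularMonomial {K : Type*} {H : Type*} [NormedAddCommGroup H]
    [InnerProductSpace ℂ H] [Group K] [CompleteSpace H] {B : Type*} [NonUnitalCStarAlgebra B]
    {φ : B →⋆ₙₐ[ℂ] (H →L[ℂ] H)} {π : K →* (B ≃⋆ₐ[ℂ] B)} {σ : K → K → Circle}
    (hσ₁ : IsNormalizedCochain₂ σ)
    (hσ : ∀ k l m, σ l m * σ k (l * m) = σ (k * l) m * σ k l) :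
    CovariantMonomials (reducedTwistedCrossedProduct φ π σ) π σ (regularMonomial φ π σ)
      (regularUnitary H σ) where
  dense := coe_reducedTwistedCrossedProduct hσ₁ hσ
  smul := smul_regularMonomial φ π
  unitary_mul := regularUnitary_mul_regularMonomial φ π hσ
  mul_unitary := regularMonomial_mul_regularUnitary φ π hσ

theorem theorem3p1 {Q G : Type*} [Group Q] [Group G]
    (ω : Q → Q → Q → Circle) (hω : IsNormalizedCocycle₃ ω)
    (ρ : G →* Q) (hρ : Function.Surjective ρ)
    (c : G → G → Circle) (hc : IsNormalizedCochain₂ c)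
    (hdc : ∀ f g h : G, cochainD₂ c f g h = ω (ρ f) (ρ g) (ρ h))
    {B : Type*} [NonUnitalCStarAlgebra B] (π : G →* (B ≃⋆ₐ[ℂ] B))
    {H : Type*} [NormedAddCommGroup H] [InnerProductSpace ℂ H] [CompleteSpace H]
    (φ : B →⋆ₙₐ[ℂ] (H →L[ℂ] H)) (hφ : Function.Injective φ) :
    Nonempty (AnomalousAction ω
      (reducedTwistedCrossedProduct φ (π.comp ρ.ker.subtype) (restrictKer ρ c))) ∧
    ∀ (s : Q → G) (hs : ∀ q, ρ (s q) = q),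
      ∃ F : AnomalousAction ω
          (reducedTwistedCrossedProduct φ (π.comp ρ.ker.subtype) (restrictKer ρ c)),
        (∀ (q : Q) (a : B) (k : ρ.ker),
          F.α q (crossedMonomial φ (π.comp ρ.ker.subtype) (restrictKer ρ c) a k) =
            (((c (kerConj ρ (s q) k) (s q))⁻¹ * c (s q) k : Circle) : ℂ) •
              crossedMonomial φ (π.comp ρ.ker.subtype) (restrictKer ρ c)
                (π (s q) a) (kerConj ρ (s q) k)) ∧
        (∀ (q r : Q)
            (x : reducedTwistedCrossedProduct φ (π.comp ρ.ker.subtype) (restrictKer ρ c)),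
          (((F.m q r).fst x : reducedTwistedCrossedProduct φ (π.comp ρ.ker.subtype)
              (restrictKer ρ c)) : EllTwo ρ.ker H →L[ℂ] EllTwo ρ.ker H) =
            (((c (s q) (s r))⁻¹ * c (sectionCocycle ρ s hs q r) (s (q * r)) : Circle) : ℂ) •
              (star (regularUnitary H (restrictKer ρ c) (sectionCocycle ρ s hs q r)) * x)) := by
  have hσ₁ : IsNormalizedCochain₂ (restrictKer ρ c) := isNormalizedCochain₂_restrictKer hc
  have hσ := restrictKer_cocycle hω.normalized hdc
  -- The automorphisms are chosen for all `g` in `G`, before any section, so one family serves every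
  -- section.
  choose α hα using fun g => exists_crossedProduct_starAlgEquiv (φ := φ)
    (π := π.comp ρ.ker.subtype) (χ := fun k : ρ.ker => conjScalar c g k) hφ hσ₁ hσ
    (map_kerConj_apply g) (conjScalar_cocycle hω.normalized hdc g)
  have key := exists_anomalousAction_of_covariantMonomials hω.normalized hdc
    (covariantMonomials_regularMonomial (φ := φ) hσ₁ hσ) (regularUnitary_mul hσ)
    (fun k x => by rw [← mul_assoc, star_regularUnitary_mul_self, one_mul])
    (fun k x => by rw [← mul_assoc, regularUnitary_mul_star_self hσ₁ hσ, one_mul]) hα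
  refine ⟨?_, fun s hs => ?_⟩
  · obtain ⟨F, -⟩ := key (Function.surjInv hρ) (Function.surjInv_eq hρ)
    exact ⟨F⟩
  · refine (key s hs).imp fun F hF => ⟨fun q a k => Subtype.ext ?_, ?_⟩
    · exact (congrArg Subtype.val (DFunLike.congr_fun (hF.1 q) _)).trans
        ((hα (s q) a k _ rfl).trans (smul_regularMonomial φ _ _ _ _).symm)
    · exact hF.2
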